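/- Let $G$ be a finite simple graph with vertex set $V(G)=\{1,\dots,n\}$, let $K$ be a field, $S=K[x_1,\dots,x_n]$, and let $$NI(G)=\Big(\prod_{j\in N_G[i]}x_j \;:\; i\in V(G)\Big)\subseteq S$$ be the closed neighborhood ideal of $G$, where $N_G[i]$ consists of $i$ and all its neighbors in $G$. A dominating set of $G$ is a set $D\subseteq V(G)$ with $D\cap N_G[i]\neq\emptyset$ for every vertex $i$; it is minimal if no proper subset of it is dominating. Let $\gamma_0(G)$ be the maximum size of a minimal dominating set of $G$, $\alpha(G)$ the maximum size of an independent set of $G$, and $\tau(G)$ the minimum size of a vertex cover of $G$. Let $\operatorname{pd}(S/NI(G))$ be the projective dimension of $S/NI(G)$ as an $S$-module, and let $\operatorname{depth}(S/NI(G))$ be the supremum of the lengths of $S/NI(G)$-regular sequences in the ideal $(x_1,\dots,x_n)$ of $S$. Then (a) $\operatorname{pd}(S/NI(G))\ \ge\ \gamma_0(G)\ \ge\ \alpha(G)$; (b) $\operatorname{depth}(S/NI(G))\ \le\ \tau(G)$. -/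

import Mathlib

/-- The closed neighborhood `N_G[i]`: the vertex `i` together with all its neighbors. -/
def SimpleGraph.closedNeighborSet {V : Type*} (G : SimpleGraph V) (i : V) : Set V :=
  insert i (G.neighborSet i)

/-- `D` is a dominating set of `G`: it meets the closed neighborhood of every vertex. -/
def SimpleGraph.IsDominatingSet {V : Type*} (G : SimpleGraph V) (D : Finset V) : Prop :=
  ∀ i : V, ((D : Set V) ∩ G.closedNeighborSet i).Nonempty

open Classical in
/-- `γ₀(G)`: the maximum size of an (inclusion-)minimal dominating set of `G`. -/
noncomputable def SimpleGraph.upperDominationNum {V : Type*} [Fintype V]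
    (G : SimpleGraph V) : ℕ :=
  (Finset.univ.filter fun D : Finset V => Minimal G.IsDominatingSet D).sup Finset.card

open Classical in
/-- The squarefree monomial `u_{i,G}`, the product of the variables indexed by `N_G[i]`. -/
noncomputable def SimpleGraph.closedNeighborMonomial (K : Type*) [Field K]
    {V : Type*} [Fintype V] (G : SimpleGraph V) (i : V) : MvPolynomial V K :=
  ∏ j ∈ Finset.univ.filter (fun j => j ∈ G.closedNeighborSet i), MvPolynomial.X j

/-- The closed neighborhood ideal `NI(G) = (u_{i,G} : i ∈ V(G))`. -/
noncomputable def SimpleGraph.closedNeighborIdeal (K : Type*) [Field K]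
    {V : Type*} [Fintype V] (G : SimpleGraph V) : Ideal (MvPolynomial V K) :=
  Ideal.span (Set.range (G.closedNeighborMonomial K))

/-- The depth (grade) of `M` with respect to the ideal `I`: the supremum of the lengths of
`M`-regular sequences consisting of elements of `I`. The depth of a finitely generated graded
module over a polynomial ring over a field is the case where `I` is generated by the variables. -/
noncomputable def Ideal.regularDepth {R : Type*} [CommRing R] (I : Ideal R)
    (M : Type*) [AddCommGroup M] [Module R M] : ℕ∞ :=
  ⨆ (rs : List R) (_ : (∀ r ∈ rs, r ∈ I) ∧ RingTheory.Sequence.IsRegular M rs),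
    (rs.length : ℕ∞)

/-! ### Independent sets and minimal dominating sets. -/

namespace SimpleGraph

variable {V : Type*} {G : SimpleGraph V}

/-! For a minimal dominating set `D`, let `P` be the prime generated by the variables of `D`. Each
`d ∈ D` has a closed neighborhood meeting `D` only in `d`, so its monomial is `X d * f` with `f ∉
P`. Hence `NI(G)` and `P` agree after localizing at `P`, and `P` is a minimal prime of `NI(G)`.
Localization does not raise projective dimension, and `P` is generated by a regular sequence of
length `|D|`; this gives `pd ≥ |D|`. As `P` is an associated prime, depth is at most `dim S/P = n -
|D|`. Maximal independent sets are minimal dominating sets; one containing the complement of a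
vertex cover bounds depth by the size of the cover. -/

lemma mem_closedNeighborSet_iff {i j : V} :
    j ∈ G.closedNeighborSet i ↔ j = i ∨ G.Adj i j := by
  simp [closedNeighborSet]

lemma isDominatingSet_of_maximal_isIndepSet {D : Finset V}
    (hD : Maximal (fun s : Finset V => G.IsIndepSet s) D) : G.IsDominatingSet D := by
  classical
  intro i
  by_contra hne
  have hdisj : ∀ j ∈ D, j ≠ i ∧ ¬ G.Adj i j := by
    intro j hj
    by_contra h
    exact hne ⟨j, hj, mem_closedNeighborSet_iff.2 (by tauto)⟩
  have hins : G.IsIndepSet ((insert i D : Finset V) : Set V) := by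
    rw [Finset.coe_insert]
    refine hD.1.insert fun j hj _ => ?_
    exact ⟨(hdisj j hj).2, fun h => (hdisj j hj).2 h.symm⟩
  have := hD.2 hins (Finset.subset_insert i D) (Finset.mem_insert_self i D)
  exact (hdisj i this).1 rfl

/-- By independence, a vertex `d ∈ D` can be dominated from within `D` only by itself. -/
lemma minimal_isDominatingSet_of_maximal_isIndepSet {D : Finset V}
    (hD : Maximal (fun s : Finset V => G.IsIndepSet s) D) : Minimal G.IsDominatingSet D := by
  refine ⟨isDominatingSet_of_maximal_isIndepSet hD, fun E hE hED d hd => ?_⟩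
  obtain ⟨j, hjE, hj⟩ := hE d
  rcases mem_closedNeighborSet_iff.1 hj with rfl | hadj
  · exact hjE
  · exact absurd hadj (hD.1 hd (hED hjE) hadj.ne)

lemma IsIndepSet.exists_maximal_superset [Finite V] {s : Finset V} (hs : G.IsIndepSet s) :
    ∃ D, s ⊆ D ∧ Maximal (fun s : Finset V => G.IsIndepSet s) D :=
  Finite.exists_le_maximal (p := fun s : Finset V => G.IsIndepSet s) hs

/-- Every element of a minimal dominating set has a private closed neighborhood. -/
lemma exists_closedNeighborSet_inter_eq_singleton {D : Finset V}
    (hD : Minimal G.IsDominatingSet D) {d : V} (hd : d ∈ D) :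
    ∃ i, d ∈ G.closedNeighborSet i ∧ ∀ j ∈ D, j ∈ G.closedNeighborSet i → j = d := by
  classical
  have hnot : ¬ G.IsDominatingSet (D.erase d) := fun h =>
    Finset.notMem_erase d D (hD.2 h (Finset.erase_subset d D) hd)
  simp only [IsDominatingSet, not_forall, Set.not_nonempty_iff_eq_empty] at hnot
  obtain ⟨i, hi⟩ := hnot
  have huniq : ∀ j ∈ D, j ∈ G.closedNeighborSet i → j = d := by
    intro j hj hji
    by_contra hjd
    have : j ∈ ((D.erase d : Finset V) : Set V) ∩ G.closedNeighborSet i :=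
      ⟨Finset.mem_coe.2 (Finset.mem_erase.2 ⟨hjd, hj⟩), hji⟩
    rwa [hi] at this
  obtain ⟨j, hj, hji⟩ := hD.1 i
  exact ⟨i, huniq j hj hji ▸ hji, huniq⟩

variable [Fintype V]

lemma card_le_upperDominationNum {D : Finset V} (hD : Minimal G.IsDominatingSet D) :
    D.card ≤ G.upperDominationNum := by
  classical
  exact Finset.le_sup (f := Finset.card) (by simpa using hD)

lemma indepNum_le_upperDominationNum : G.indepNum ≤ G.upperDominationNum := by
  obtain ⟨s, hs⟩ := G.exists_isNIndepSet_indepNum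
  obtain ⟨D, hsD, hD⟩ := hs.isIndepSet.exists_maximal_superset
  rw [← hs.card_eq]
  exact (Finset.card_le_card hsD).trans
    (card_le_upperDominationNum (minimal_isDominatingSet_of_maximal_isIndepSet hD))

end SimpleGraph

/-! ### Primes generated by variables. -/

namespace MvPolynomial

variable {K V : Type*} [Field K]

open Classical in
/-- The algebra map setting the variables in `s` to zero. -/
noncomputable def killVars (K : Type*) [Field K] {V : Type*} (s : Set V) :
    MvPolynomial V K →ₐ[K] MvPolynomial {i // i ∉ s} K :=
  aeval fun i => if h : i ∈ s then 0 else X ⟨i, h⟩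

lemma killVars_X_of_mem {s : Set V} {i : V} (h : i ∈ s) : killVars K s (X i) = 0 := by
  simp [killVars, h]

lemma killVars_X_of_notMem {s : Set V} {i : V} (h : i ∉ s) :
    killVars K s (X i) = X ⟨i, h⟩ := by
  simp [killVars, h]

lemma killVars_rename (s : Set V) (f : MvPolynomial {i // i ∉ s} K) :
    killVars K s (rename Subtype.val f) = f := by
  have : (killVars K s).comp (rename Subtype.val) = AlgHom.id K _ := by
    ext i
    simp [killVars_X_of_notMem i.2]
  exact DFunLike.congr_fun this f

lemma killVars_surjective (s : Set V) : Function.Surjective (killVars K s) :=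
  fun f => ⟨_, killVars_rename s f⟩

lemma ker_killVars (s : Set V) :
    RingHom.ker (killVars K s) = Ideal.span (X '' s) := by
  apply le_antisymm
  · intro f hf
    have : (Ideal.Quotient.mkₐ K (Ideal.span (X '' s : Set (MvPolynomial V K)))).comp
        ((rename Subtype.val).comp (killVars K s)) = Ideal.Quotient.mkₐ K _ := by
      ext i
      by_cases h : i ∈ s
      · have : Ideal.Quotient.mk (Ideal.span (X '' s : Set (MvPolynomial V K))) (X i) = 0 :=
          Ideal.Quotient.eq_zero_iff_mem.2 (Ideal.subset_span ⟨i, h, rfl⟩)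
        simp [killVars_X_of_mem h, this]
      · simp [killVars_X_of_notMem h]
    have h2 := DFunLike.congr_fun this f
    rw [RingHom.mem_ker] at hf
    simp only [AlgHom.comp_apply, hf, map_zero] at h2
    exact Ideal.Quotient.eq_zero_iff_mem.1 h2.symm
  · rw [Ideal.span_le]
    rintro _ ⟨i, hi, rfl⟩
    exact killVars_X_of_mem hi

instance isPrime_span_X_image (s : Set V) :
    (Ideal.span (X '' s : Set (MvPolynomial V K))).IsPrime := by
  rw [← ker_killVars]
  exact RingHom.ker_isPrime _

lemma X_mem_span_X_image_iff {s : Set V} {i : V} :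
    (X i : MvPolynomial V K) ∈ Ideal.span (X '' s) ↔ i ∈ s := by
  refine ⟨fun h => ?_, fun h => Ideal.subset_span ⟨i, h, rfl⟩⟩
  by_contra hi
  rw [← ker_killVars, RingHom.mem_ker, killVars_X_of_notMem hi] at h
  exact X_ne_zero _ h

lemma ringKrullDim_quotient_span_X_image [Finite V] (s : Set V) :
    ringKrullDim (MvPolynomial V K ⧸ Ideal.span (X '' s : Set (MvPolynomial V K))) =
      Nat.card {i // i ∉ s} := by
  rw [← ker_killVars]
  rw [ringKrullDim_eq_of_ringEquiv
    (Ideal.quotientKerAlgEquivOfSurjective (killVars_surjective (K := K) s)).toRingEquiv, ringKrullDim_of_isNoetherianRing]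
  simp

/-- Each variable lies outside the prime generated by the earlier ones. -/
lemma isWeaklyRegular_map_X {l : List V} (hl : l.Nodup) :
    RingTheory.Sequence.IsWeaklyRegular (MvPolynomial V K)
      (l.map (X : V → MvPolynomial V K)) := by
  refine ⟨fun i hi => ?_⟩
  have hi' : i < l.length := by simpa using hi
  have hspan : Ideal.ofList ((l.map (X : V → MvPolynomial V K)).take i) =
      Ideal.span (X '' {v | v ∈ l.take i}) := by
    rw [Ideal.ofList]
    congr 1
    ext f
    rw [← List.map_take]
    simp only [List.mem_map, Set.mem_image, Set.mem_ofPred_eq]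
  have hnot : l[i] ∉ l.take i := by
    rw [List.mem_take_iff_getElem]
    rintro ⟨j, hj, h⟩
    have := (hl.getElem_inj_iff).1 h
    omega
  rw [isSMulRegular_quotient_iff_mem_of_smul_mem]
  intro f hf
  simp only [smul_eq_mul, Ideal.mul_top, hspan, List.getElem_map] at hf ⊢
  exact ((isPrime_span_X_image _).mem_or_mem hf).resolve_left
    (fun h => hnot ((X_mem_span_X_image_iff (s := {v | v ∈ l.take i})).1 h))

end MvPolynomial

/-! ### Regular sequences and chains of associated primes. -/

open Module Pointwise RingTheory.Sequence

section
variable {R M : Type*} [CommRing R] [AddCommGroup M] [Module R M]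

/-- A Nakayama-type statement: the finitely generated module `N` cannot be multiplied into `I • N`
by an element outside a prime ideal containing `I` and the annihilator of `N`. -/
lemma Module.mem_of_smul_mem_smul_top [Module.Finite R M] {I m : Ideal R} [m.IsPrime]
    (hI : I ≤ m) (hann : Module.annihilator R M ≤ m) {s : R}
    (h : ∀ z : M, s • z ∈ I • (⊤ : Submodule R M)) : s ∈ m := by
  -- Determinant trick: `p(s)` kills `M`, and modulo `m` it reduces to a power of `s`.
  obtain ⟨p, hp, -, hcoeff, heval⟩ :=
    LinearMap.exists_monic_and_natDegree_eq_and_coeff_mem_pow_and_aeval_eq_zero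
      R (algebraMap R (Module.End R M) s) I (by
        rintro _ ⟨z, rfl⟩
        simpa using h z)
  have hs : p.eval s ∈ m := by
    apply hann
    rw [Module.mem_annihilator]
    intro z
    have := DFunLike.congr_fun heval z
    rwa [Polynomial.aeval_algebraMap_apply, Polynomial.coe_aeval_eq_eval] at this
  rw [Polynomial.eval_eq_sum_range, Finset.sum_range_succ, hp.coeff_natDegree, one_mul] at hs
  have hsum : ∑ i ∈ Finset.range p.natDegree, p.coeff i * s ^ i ∈ m := by
    refine Ideal.sum_mem _ fun i hi => Ideal.mul_mem_right _ _ (hI ?_)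
    exact Ideal.pow_le_self (by have := Finset.mem_range.1 hi; omega) (hcoeff i)
  exact ‹m.IsPrime›.mem_of_pow_mem _ ((Ideal.add_mem_iff_right _ hsum).1 hs)

/-- If `x` is `M`-regular and `p` is an associated prime of `M`, with `x` and `p` contained in a
prime ideal `m`, then `M ⧸ x M` has an associated prime between `p` and `m` that contains `x`. -/
lemma exists_mem_associatedPrimes_quotSMulTop [IsNoetherianRing R] [Module.Finite R M]
    {m p : Ideal R} [m.IsPrime] (hp : p ∈ associatedPrimes R M) (hpm : p ≤ m) {x : R}
    (hx : x ∈ m) (hreg : IsSMulRegular M x) :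
    ∃ q ∈ associatedPrimes R (QuotSMulTop x M), p < q ∧ q ≤ m := by
  obtain ⟨hprime, z₀, hz₀⟩ := isAssociatedPrime_iff.1 hp
  have hz₀' : ∀ r : R, r ∈ p ↔ r • z₀ = 0 := fun r => by
    rw [hz₀, Submodule.mem_colon_singleton, Submodule.mem_bot]
  have hxp : x ∉ p := fun h => by
    have h0 : z₀ = 0 := hreg (by simpa using (hz₀' x).1 h)
    exact hprime.ne_top ((Ideal.eq_top_iff_one _).2 ((hz₀' 1).2 (by simp [h0])))
  let N : Submodule R M := Submodule.torsionBySet R M p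
  have hN : ∀ z : M, z ∈ N ↔ ∀ r ∈ p, r • z = 0 := fun z => by
    simp [N, Submodule.mem_torsionBySet_iff]
  -- Otherwise `N = xN` locally at `m`, as regularity of `x` forces `xM ∩ N = xN`; Nakayama then
  -- contradicts `0 ≠ z₀ ∈ N`.
  have key : ∃ z ∈ N, ∀ s : R, s • z ∈ x • (⊤ : Submodule R M) → s ∈ m := by
    by_contra! hcon
    have hloc : ∀ z : N, ∃ s, s ∉ m ∧ s • z ∈ Ideal.span {x} • (⊤ : Submodule R N) := by
      rintro ⟨z, hz⟩
      obtain ⟨s, hs, hsm⟩ := hcon z hz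
      obtain ⟨y, -, hy⟩ := hs
      have hy : x • y = s • z := hy
      have hyN : y ∈ N := (hN y).2 fun r hr => hreg (by
        simp only [smul_zero]
        rw [smul_comm, hy, smul_comm, (hN z).1 hz r hr, smul_zero])
      refine ⟨s, hsm, ?_⟩
      have : s • (⟨z, hz⟩ : N) = x • (⟨y, hyN⟩ : N) := Subtype.ext hy.symm
      rw [this]
      exact Submodule.smul_mem_smul (Ideal.mem_span_singleton_self x) trivial
    choose s hsm hs using hloc
    obtain ⟨t, ht⟩ := (Module.Finite.fg_top : (⊤ : Submodule R N).FG)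
    have hprod : ∏ z ∈ t, s z ∈ m := by
      refine Module.mem_of_smul_mem_smul_top (M := N) (I := Ideal.span {x})
        ((Ideal.span_singleton_le_iff_mem m).2 hx) (fun r hr => hpm ((hz₀' r).2 ?_)) fun z => ?_
      · have hz₀N : z₀ ∈ N := (hN z₀).2 fun r hr => (hz₀' r).1 hr
        simpa using congrArg Subtype.val (Module.mem_annihilator.1 hr ⟨z₀, hz₀N⟩)
      · have hz : z ∈ Submodule.span R (t : Set N) := ht ▸ trivial
        induction hz using Submodule.span_induction with
        | mem z hz =>
          obtain ⟨c, hc⟩ := Finset.dvd_prod_of_mem s hz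
          rw [hc, mul_comm, mul_smul]
          exact Submodule.smul_mem _ _ (hs z)
        | zero => simp
        | add a b _ _ ha hb => rw [smul_add]; exact Submodule.add_mem _ ha hb
        | smul r a _ ha => rw [smul_comm]; exact Submodule.smul_mem _ _ ha
    obtain ⟨z, -, hz⟩ := (Ideal.IsPrime.prod_mem_iff).1 hprod
    exact hsm z hz
  obtain ⟨z, hzN, hz⟩ := key
  let zbar : QuotSMulTop x M := Submodule.Quotient.mk z
  let L : Submodule R (QuotSMulTop x M) := Submodule.span R {zbar}
  have hannL : ∀ r : R, r ∈ Module.annihilator R L ↔ r • z ∈ x • (⊤ : Submodule R M) := fun r => by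
    change r ∈ L.annihilator ↔ _
    rw [Submodule.mem_annihilator_span_singleton, ← Submodule.Quotient.mk_smul,
      Submodule.Quotient.mk_eq_zero]
  -- The annihilator of the class of `z` contains both `p` and `x`, and lies in `m`.
  obtain ⟨q, hq, hqm⟩ := Ideal.exists_minimalPrimes_le (I := Module.annihilator R L) (J := m)
    (fun r hr => hz r ((hannL r).1 hr))
  have hle : Module.annihilator R L ≤ q := hq.1.2
  refine ⟨q, associatedPrimes.subset_of_injective L.injective_subtype
    (Module.associatedPrimes.minimalPrimes_annihilator_subset_associatedPrimes R L hq), ?_, hqm⟩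
  refine lt_of_le_of_ne (fun r hr => hle ((hannL r).2 ?_)) fun h => hxp (h ▸ hle ((hannL x).2 ?_))
  · rw [(hN z).1 hzN r hr]; exact Submodule.zero_mem _
  · exact Submodule.smul_mem_pointwise_smul _ _ _ trivial

end

/-- Each quotient by a term of the sequence yields a strictly larger associated prime inside `m`, so
the sequence builds a chain above `p`. -/
lemma RingTheory.Sequence.IsWeaklyRegular.length_le_coheight {R : Type*} [CommRing R]
    [IsNoetherianRing R] {m : Ideal R} [m.IsPrime] {rs : List R} (hm : ∀ r ∈ rs, r ∈ m)
    {M : Type*} [AddCommGroup M] [Module R M] [Module.Finite R M]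
    (hreg : IsWeaklyRegular M rs) (p : PrimeSpectrum R)
    (hp : p.asIdeal ∈ associatedPrimes R M) (hpm : p.asIdeal ≤ m) :
    (rs.length : ℕ∞) ≤ Order.coheight p := by
  induction rs generalizing M p with
  | nil => simp
  | cons x rs ih =>
    rw [isWeaklyRegular_cons_iff] at hreg
    obtain ⟨q, hq, hpq, hqm⟩ := exists_mem_associatedPrimes_quotSMulTop hp hpm
      (hm x List.mem_cons_self) hreg.1
    have := ih (fun r hr => hm r (List.mem_cons_of_mem _ hr)) hreg.2 ⟨q, hq.isPrime⟩ hq hqm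
    rw [List.length_cons, Nat.cast_add, Nat.cast_one]
    exact (add_le_add_left this 1).trans (Order.coheight_add_one_le hpq)

lemma PrimeSpectrum.coheight_eq_ringKrullDim_quotient {R : Type*} [CommRing R]
    (p : PrimeSpectrum R) :
    (Order.coheight p : WithBot ℕ∞) = ringKrullDim (R ⧸ p.asIdeal) := by
  rw [Order.coheight_eq_krullDim_Ici, ringKrullDim_quotient]
  rfl

/-! ### Projective dimension by localization. -/

open CategoryTheory

universe u

/-- If an ideal `I` and the weakly regular sequence `rs` in the prime `P` generate the same ideal
after localization at `P`, then `R ⧸ I` has projective dimension at least the length of `rs`. -/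
lemma length_le_projectiveDimension_quotient {R : Type u} [CommRing R] [IsNoetherianRing R]
    (I P : Ideal R) [P.IsPrime] (rs : List R)
    (hreg : RingTheory.Sequence.IsWeaklyRegular R rs) (hP : ∀ r ∈ rs, r ∈ P)
    (hI : I.map (algebraMap R (Localization.AtPrime P)) =
      (Ideal.ofList rs).map (algebraMap R (Localization.AtPrime P))) :
    (rs.length : WithBot ℕ∞) ≤ projectiveDimension (ModuleCat.of R (R ⧸ I)) := by
  let A := Localization.AtPrime P
  refine le_trans ?_
    ((ModuleCat.of R (R ⧸ I)).projectiveDimension_le_projectiveDimension_of_isLocalizedModule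
      P.primeCompl)
  have hregA : RingTheory.Sequence.IsWeaklyRegular A (rs.map (algebraMap R A)) :=
    hreg.of_isLocalization A P.primeCompl
  have hmem : ∀ r ∈ rs.map (algebraMap R A), r ∈ IsLocalRing.maximalIdeal A := by
    intro r hr
    obtain ⟨a, ha, rfl⟩ := List.mem_map.1 hr
    exact (IsLocalization.AtPrime.to_map_mem_maximal_iff A P a).2 (hP a ha)
  have hpd := ModuleCat.projectiveDimension_quotient_eq_add_length_of_isWeaklyRegular
    (ModuleCat.of A A) _ hregA hmem
  rw [ModuleCat.projectiveDimension_eq_zero_of_projective (ModuleCat.of A A), zero_add, List.length_map] at hpd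
  rw [← hpd]
  have hideal : Ideal.ofList (rs.map (algebraMap R A)) • (⊤ : Submodule A A) =
      Submodule.localized' A P.primeCompl (Algebra.linearMap R A) I := by
    rw [Ideal.localized'_eq_map, hI, Ideal.map_ofList, smul_eq_mul, Ideal.mul_top]
  let N := (ModuleCat.of R (R ⧸ I)).localizedModule P.primeCompl
  let g : (R ⧸ I) →ₗ[R] N := (ModuleCat.of R (R ⧸ I)).localizedModuleMkLinearMap P.primeCompl
  have : IsLocalizedModule P.primeCompl g :=
    ModuleCat.localizedModule_isLocalizedModule (ModuleCat.of R (R ⧸ I)) P.primeCompl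
  let e : (A ⧸ Ideal.ofList (rs.map (algebraMap R A)) • (⊤ : Submodule A A)) ≃ₗ[A]
      N :=
    (Submodule.quotEquivOfEq _ _ hideal).trans
      ((IsLocalizedModule.linearEquiv P.primeCompl
        (Submodule.toLocalizedQuotient' A P.primeCompl (Algebra.linearMap R A) I)
        g).extendScalarsOfIsLocalization P.primeCompl A)
  exact (projectiveDimension_eq_of_iso e.toModuleIso).le

open CategoryTheory MvPolynomial

/-! ### The bounds for the closed neighborhood ideal. -/

namespace SimpleGraph

variable {K : Type*} [Field K] {V : Type*} [Fintype V] {G : SimpleGraph V}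

lemma closedNeighborIdeal_le_span_X_image {D : Finset V} (hD : G.IsDominatingSet D) :
    G.closedNeighborIdeal K ≤ Ideal.span (X '' (D : Set V)) := by
  classical
  refine Ideal.span_le.2 ?_
  rintro _ ⟨i, rfl⟩
  obtain ⟨j, hjD, hj⟩ := hD i
  refine Ideal.mem_of_dvd _ (Finset.dvd_prod_of_mem X ?_)
    (Ideal.subset_span (Set.mem_image_of_mem X hjD))
  simpa using hj

lemma exists_eq_X_mul_mem_closedNeighborIdeal {D : Finset V}
    (hD : Minimal G.IsDominatingSet D) {d : V} (hd : d ∈ D) :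
    ∃ f ∉ Ideal.span (X '' (D : Set V) : Set (MvPolynomial V K)),
      X d * f ∈ G.closedNeighborIdeal K := by
  classical
  obtain ⟨i, hdi, huniq⟩ := exists_closedNeighborSet_inter_eq_singleton hD hd
  refine ⟨∏ j ∈ (Finset.univ.filter fun j => j ∈ G.closedNeighborSet i).erase d, X j, ?_, ?_⟩
  · rw [Ideal.IsPrime.prod_mem_iff]
    rintro ⟨j, hj, hjD⟩
    simp only [Finset.mem_erase, Finset.mem_filter, Finset.mem_univ, true_and] at hj
    exact hj.1 (huniq j (X_mem_span_X_image_iff.1 hjD) hj.2)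
  · rw [Finset.mul_prod_erase _ _ (by simpa using hdi)]
    exact Ideal.subset_span ⟨i, by unfold closedNeighborMonomial; congr!⟩

lemma span_X_image_mem_minimalPrimes {D : Finset V} (hD : Minimal G.IsDominatingSet D) :
    Ideal.span (X '' (D : Set V)) ∈ (G.closedNeighborIdeal K).minimalPrimes := by
  refine ⟨⟨inferInstance, closedNeighborIdeal_le_span_X_image hD.1⟩, ?_⟩
  rintro Q ⟨hQ, hIQ⟩ hQP
  refine Ideal.span_le.2 ?_
  rintro _ ⟨d, hd, rfl⟩
  obtain ⟨f, hf, hdf⟩ := exists_eq_X_mul_mem_closedNeighborIdeal (K := K) hD hd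
  exact (hQ.mem_or_mem (hIQ hdf)).resolve_right fun h => hf (hQP h)

lemma card_le_projectiveDimension {D : Finset V} (hD : Minimal G.IsDominatingSet D) :
    (D.card : WithBot ℕ∞) ≤ projectiveDimension
      (ModuleCat.of (MvPolynomial V K) (MvPolynomial V K ⧸ G.closedNeighborIdeal K)) := by
  have hspan : Ideal.ofList (D.toList.map (X : V → MvPolynomial V K)) =
      Ideal.span (X '' (D : Set V)) := by
    rw [Ideal.ofList]
    congr 1
    ext f
    simp [eq_comm]
  have := length_le_projectiveDimension_quotient (G.closedNeighborIdeal K)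
    (Ideal.span (X '' (D : Set V))) (D.toList.map X) (isWeaklyRegular_map_X D.nodup_toList)
    (fun r hr => by
      obtain ⟨d, hd, rfl⟩ := List.mem_map.1 hr
      exact Ideal.subset_span ⟨d, Finset.mem_toList.1 hd, rfl⟩) ?_
  · simpa using this
  rw [hspan]
  refine le_antisymm (Ideal.map_mono (closedNeighborIdeal_le_span_X_image hD.1)) ?_
  rw [Ideal.map_span, Ideal.span_le]
  rintro _ ⟨_, ⟨d, hd, rfl⟩, rfl⟩
  -- The cofactor `f` becomes a unit in the localization, leaving `X d` in the extended ideal.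
  obtain ⟨f, hf, hdf⟩ := exists_eq_X_mul_mem_closedNeighborIdeal (K := K) hD hd
  have hunit := IsLocalization.map_units
    (Localization.AtPrime (Ideal.span (X '' (D : Set V) : Set (MvPolynomial V K))))
    (⟨f, hf⟩ : (Ideal.span (X '' (D : Set V) : Set (MvPolynomial V K))).primeCompl)
  have := Ideal.mem_map_of_mem (algebraMap _
    (Localization.AtPrime (Ideal.span (X '' (D : Set V) : Set (MvPolynomial V K))))) hdf
  rw [map_mul] at this
  exact (Ideal.mul_unit_mem_iff_mem _ hunit).1 this

lemma upperDominationNum_le_projectiveDimension :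
    ((G.upperDominationNum : ℕ∞) : WithBot ℕ∞) ≤ projectiveDimension
      (ModuleCat.of (MvPolynomial V K) (MvPolynomial V K ⧸ G.closedNeighborIdeal K)) := by
  classical
  obtain ⟨D₀, -, hD₀⟩ := IsIndepSet.exists_maximal_superset (G := G) (s := ∅) (by simp)
  obtain ⟨D, hD, hcard⟩ := Finset.exists_mem_eq_sup
    (Finset.univ.filter fun D : Finset V => Minimal G.IsDominatingSet D)
    ⟨D₀, by simpa using minimal_isDominatingSet_of_maximal_isIndepSet hD₀⟩ Finset.card
  have : G.upperDominationNum = D.card := by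
    rw [← hcard]; unfold upperDominationNum; congr!
  rw [this]
  exact card_le_projectiveDimension (by simpa using hD)

lemma regularDepth_le_card_compl {D : Finset V} (hD : Minimal G.IsDominatingSet D) :
    (idealOfVars V K).regularDepth (MvPolynomial V K ⧸ G.closedNeighborIdeal K) ≤
      Nat.card {i // i ∉ (D : Set V)} := by
  refine iSup₂_le fun rs ⟨hrs, hreg⟩ => ?_
  have : (idealOfVars V K).IsPrime := by
    rw [idealOfVars, ← Set.image_univ]; infer_instance
  let p : PrimeSpectrum (MvPolynomial V K) := ⟨Ideal.span (X '' (D : Set V)), inferInstance⟩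
  have hlen := hreg.toIsWeaklyRegular.length_le_coheight hrs p
    (Module.associatedPrimes.minimalPrimes_annihilator_subset_associatedPrimes _ _ (by
      rw [Ideal.annihilator_quotient]
      exact span_X_image_mem_minimalPrimes hD))
    (Ideal.span_mono (Set.image_subset_range _ _))
  rw [← WithBot.coe_le_coe, p.coheight_eq_ringKrullDim_quotient,
    ringKrullDim_quotient_span_X_image] at hlen
  exact_mod_cast hlen

lemma regularDepth_le_vertexCoverNum :
    (idealOfVars V K).regularDepth (MvPolynomial V K ⧸ G.closedNeighborIdeal K) ≤
      G.vertexCoverNum := by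
  classical
  refine le_iInf₂ fun C hC => ?_
  obtain ⟨D, hCD, hD⟩ := IsIndepSet.exists_maximal_superset (G := G) (s := Cᶜ.toFinset)
    (by simpa using hC)
  refine (regularDepth_le_card_compl (minimal_isDominatingSet_of_maximal_isIndepSet hD)).trans ?_
  change ((Nat.card ((D : Set V)ᶜ : Set V) : ℕ) : ℕ∞) ≤ _
  rw [Nat.card_coe_set_eq, Set.Finite.cast_ncard_eq (Set.toFinite _)]
  refine Set.encard_le_encard fun i hi => ?_
  by_contra hiC
  exact hi (hCD (by simpa using hiC))

end SimpleGraph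

theorem proposition3p5 {K : Type*} [Field K] {V : Type*} [Fintype V] (G : SimpleGraph V) :
    (((G.upperDominationNum : ℕ∞) : WithBot ℕ∞) ≤
        CategoryTheory.projectiveDimension
          (ModuleCat.of (MvPolynomial V K) (MvPolynomial V K ⧸ G.closedNeighborIdeal K)) ∧
      G.indepNum ≤ G.upperDominationNum) ∧
    (MvPolynomial.idealOfVars V K).regularDepth
        (MvPolynomial V K ⧸ G.closedNeighborIdeal K) ≤ G.vertexCoverNum :=
  ⟨⟨SimpleGraph.upperDominationNum_le_projectiveDimension,
    SimpleGraph.indepNum_le_upperDominationNum⟩, SimpleGraph.regularDepth_le_vertexCoverNum⟩
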